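/- Fix $n\ge 4$ and put $v=n(n-3)/2$. For all dimensions $p,q$ let $(X_1,Y_1),\dots,(X_n,Y_n)$ be i.i.d. copies of a random vector $(X,Y)$ in $\mathbb R^p\times\mathbb R^q$ (whose law may depend on $(p,q)$), $X_s=(x_{s1},\dots,x_{sp})$, $Y_s=(y_{s1},\dots,y_{sq})$, and write $\mathbf X=(X_1,\dots,X_n)^T$, $\mathbf Y=(Y_1,\dots,Y_n)^T$. Let $k,l:\mathbb R\times\mathbb R\to\mathbb R$ be measurable symmetric kernels. For $s\neq t$ put $$k_{st}(i)=k(x_{si},x_{ti})-E[k(x_{si},x_{ti})\mid x_{si}]-E[k(x_{si},x_{ti})\mid x_{ti}]+E[k(x_{si},x_{ti})],$$ define $l_{st}(j)$ in the same way from $l$ and the $y_{sj}$, and put $k_{ss}(i)=l_{ss}(j)=0$; here $k(x_{si},x_{ti})$ and $l(y_{sj},y_{tj})$, $s\ne t$, are assumed integrable, and $k_{st}(i)$, $l_{st}(j)$ square integrable. For an $n\times n$ matrix $\mathbf A=(a_{st})$ its $\mathcal U$-centered version $\widetilde{\mathbf A}=(\tilde a_{st})$ has zero diagonal and, for $s\ne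 t$, $$\tilde a_{st}=a_{st}-\tfrac1{n-2}\sum_{w} a_{sw}-\tfrac1{n-2}\sum_{u} a_{ut}+\tfrac1{(n-1)(n-2)}\sum_{u,w}a_{uw},$$ and $(\widetilde{\mathbf A}\cdot\widetilde{\mathbf B})=\frac1{n(n-3)}\sum_{s\ne t}\tilde a_{st}\tilde b_{st}$. With $\mathbf K(i)=(k_{st}(i))_{s,t}$ and $\mathbf L(j)=(l_{st}(j))_{s,t}$ let $$uCov_n^2(\mathbf X,\mathbf Y)=\frac1{\sqrt{pq}}\sum_{i=1}^p\sum_{j=1}^q(\widetilde{\mathbf K}(i)\cdot\widetilde{\mathbf L}(j)),$$ and define $uCov_n^2(\mathbf X,\mathbf X)$ (using $k$ twice) and $uCov_n^2(\mathbf Y,\mathbf Y)$ (using $l$ twice) in the same way. Assume: (D1) there are constants $0<a\le b<\infty$ and $0<a'\le b'<\infty$ such that, for all $p,q$, $a\le \mathrm{var}(x_i)\le E(x_i^2)\le b$ for every coordinate of $X$ and $a'\le \mathrm{var}(y_j)\le E(y_j^2)\le b'$ for every coordinate of $Y$; (D3) as $p\wedge q\to\infty$, $$\Big(p^{-1/2}\sum_{i=1}^p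 k_{st}(i),\; q^{-1/2}\sum_{j=1}^q l_{uw}(j)\Big)_{s<t,\;u<w}\overset{d}{\to}(c_{st},d_{uw})_{s<t,\;u<w},$$ where $\{c_{st},d_{uw}\}$ is jointly Gaussian, and there are constants $\sigma_x^2,\sigma_y^2,\sigma_{xy}^2$ such that for all $s<t$ $$\mathrm{var}[c_{st}]=\sigma_x^2=\lim\frac1p\sum_{i,j=1}^p\mathrm{cov}[k_{st}(i),k_{st}(j)],\qquad \mathrm{var}[d_{st}]=\sigma_y^2=\lim\frac1q\sum_{i,j=1}^q\mathrm{cov}[l_{st}(i),l_{st}(j)],$$ $$\mathrm{cov}[c_{st},d_{st}]=\sigma_{xy}^2=\lim\frac1{\sqrt{pq}}\sum_{i=1}^p\sum_{j=1}^q\mathrm{cov}[k_{st}(i),l_{st}(j)],$$ all limits being taken as $p\wedge q\to\infty$ (nothing is assumed about the other covariances, and $\sigma_{xy}^2$ may be negative). Let $\mathbf c=(c_{st})_{s<t}$, $\mathbf d=(d_{st})_{s<t}$, and let $\mathbf M$ be the $\frac{n(n-1)}2\times\frac{n(n-1)}2$ matrix of the linear map that sends the upper triangular part $(c_{st})_{s<t}$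 of a symmetric matrix $\mathbf C$ with zero diagonal to the upper triangular part of $\widetilde{\mathbf C}$. Then $\mathbf M$, which depends only on $n$, is a projection matrix ($\mathbf M^T=\mathbf M=\mathbf M^2$) of rank $v$, $$\begin{pmatrix}\mathbf c\\ \mathbf d\end{pmatrix}\sim N\left(\mathbf 0,\begin{pmatrix}\sigma_x^2\mathbf I_{n(n-1)/2}&\sigma_{xy}^2\mathbf I_{n(n-1)/2}\\ \sigma_{xy}^2\mathbf I_{n(n-1)/2}&\sigma_y^2\mathbf I_{n(n-1)/2}\end{pmatrix}\right),$$ and, as $p\wedge q\to\infty$, $$uCov_n^2(\mathbf X,\mathbf Y)\overset{d}{\to}\tfrac1v\,\mathbf c^T\mathbf M\mathbf d,$$ $$uCov_n^2(\mathbf X,\mathbf X)\overset{d}{\to}\tfrac1v\,\mathbf c^T\mathbf M\mathbf c\overset{d}{=}\tfrac{\sigma_x^2}{v}\chi^2_v,\qquad uCov_n^2(\mathbf Y,\mathbf Y)\overset{d}{\to}\tfrac1v\,\mathbf d^T\mathbf M\mathbf d\overset{d}{=}\tfrac{\sigma_y^2}{v}\chi^2_v.$$ -/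

import Mathlib

open MeasureTheory ProbabilityTheory Filter Topology
open scoped Matrix

noncomputable section

/-- The `𝒰`-centered version of a square matrix. -/
def uCenter {n : ℕ} (A : Matrix (Fin n) (Fin n) ℝ) : Matrix (Fin n) (Fin n) ℝ :=
  Matrix.of fun s t =>
    if s = t then 0
    else A s t - 1 / ((n : ℝ) - 2) * ∑ v, A s v - 1 / ((n : ℝ) - 2) * ∑ u, A u t
      + 1 / (((n : ℝ) - 1) * ((n : ℝ) - 2)) * ∑ u, ∑ v, A u v

/-- The inner product `(A · B) = (n(n-3))⁻¹ ∑_{s ≠ t} a_{st} b_{st}` of `𝒰`-centered matrices. -/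
def uInner {n : ℕ} (A B : Matrix (Fin n) (Fin n) ℝ) : ℝ :=
  1 / ((n : ℝ) * ((n : ℝ) - 3)) * ∑ s, ∑ t, if s = t then 0 else A s t * B s t

/-- The random matrix `(k_{st})` of double centered kernel distances of a scalar sample
`x_1, …, x_n`. For `s ≠ t`,
`k_{st} = k(x_s,x_t) - E[k(x_s,x_t) | x_s] - E[k(x_s,x_t) | x_t] + E[k(x_s,x_t)]`;
the diagonal is zero (for a kernel that is constant on the diagonal, the formula
itself gives `k_{ss} = 0`). -/
def doubleCentered {Ω : Type*} [MeasurableSpace Ω] {n : ℕ} (μ : Measure Ω) (k : ℝ → ℝ → ℝ)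
    (x : Fin n → Ω → ℝ) (ω : Ω) : Matrix (Fin n) (Fin n) ℝ :=
  Matrix.of fun s t =>
    if s = t then 0
    else k (x s ω) (x t ω)
      - (μ[fun ω' => k (x s ω') (x t ω') | MeasurableSpace.comap (x s) inferInstance]) ω
      - (μ[fun ω' => k (x s ω') (x t ω') | MeasurableSpace.comap (x t) inferInstance]) ω
      + ∫ ω', k (x s ω') (x t ω') ∂μ

/-- The unified statistic `uCov_n²(𝐗, 𝐘)` with kernels `k` and `l`; `X s i` is the `i`-th
coordinate of the `s`-th observation. -/
def uCov {Ω : Type*} [MeasurableSpace Ω] {n p q : ℕ} (μ : Measure Ω) (k l : ℝ → ℝ → ℝ)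
    (X : Fin n → Fin p → Ω → ℝ) (Y : Fin n → Fin q → Ω → ℝ) (ω : Ω) : ℝ :=
  1 / Real.sqrt ((p : ℝ) * (q : ℝ)) * ∑ i : Fin p, ∑ j : Fin q,
    uInner (uCenter (doubleCentered μ k (fun s => X s i) ω))
      (uCenter (doubleCentered μ l (fun s => Y s j) ω))

/-- The index set of pairs `s < t` in `{1, …, n}`; it has `n(n-1)/2` elements. -/
abbrev IdxPair (n : ℕ) : Type := {a : Fin n × Fin n // a.1 < a.2}

/-- The matrix `𝐌`: it sends the upper triangular part `(c_{st})_{s<t}` of a symmetric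
matrix `C` with zero diagonal to the upper triangular part of the `𝒰`-centered version of `C`.
Its column `b = (u, v)` is that image for the matrix with entries one
at `(u, v)` and `(v, u)`. -/
def projMatrix (n : ℕ) : Matrix (IdxPair n) (IdxPair n) ℝ :=
  Matrix.of fun a b =>
    uCenter (Matrix.single b.1.1 b.1.2 (1 : ℝ) + Matrix.single b.1.2 b.1.1 (1 : ℝ)) a.1.1 a.1.2

/-- The chi-square distribution with `v` degrees of freedom. -/
def chiSquare (v : ℕ) : Measure ℝ :=
  (Measure.pi fun _ : Fin v => gaussianReal 0 1).map fun z => ∑ i, z i ^ 2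

/-- `(X_1, Y_1), …, (X_n, Y_n)` are i.i.d. random vectors with law `P` on `ℝ^p × ℝ^q`. -/
structure IsIIDSample {Ω : Type*} [MeasurableSpace Ω] {n p q : ℕ} (μ : Measure Ω)
    (P : Measure ((Fin p → ℝ) × (Fin q → ℝ)))
    (X : Fin n → Fin p → Ω → ℝ) (Y : Fin n → Fin q → Ω → ℝ) : Prop where
  measurable_X : ∀ s i, Measurable (X s i)
  measurable_Y : ∀ s j, Measurable (Y s j)
  indep : iIndepFun
    (fun (s : Fin n) (ω : Ω) => ((fun i => X s i ω : Fin p → ℝ), (fun j => Y s j ω : Fin q → ℝ))) μ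
  law : ∀ s, HasLaw (fun ω => ((fun i => X s i ω : Fin p → ℝ), (fun j => Y s j ω : Fin q → ℝ))) P μ

/-- Uniform moment bounds: the coordinates of `X` and `Y` have variances bounded below and second
moments bounded above, uniformly over all coordinates and all dimensions `(p, q)`. -/
def UniformMomentBounds
    (P : (r : ℕ × ℕ) → Measure ((Fin r.1 → ℝ) × (Fin r.2 → ℝ))) : Prop :=
  ∃ a b a' b' : ℝ, 0 < a ∧ 0 < a' ∧ ∀ r : ℕ × ℕ,
    (∀ i : Fin r.1, MemLp (fun z => z.1 i) 2 (P r) ∧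
      a ≤ Var[fun z => z.1 i; P r] ∧ ∫ z, z.1 i ^ 2 ∂(P r) ≤ b) ∧
    (∀ j : Fin r.2, MemLp (fun z => z.2 j) 2 (P r) ∧
      a' ≤ Var[fun z => z.2 j; P r] ∧ ∫ z, z.2 j ^ 2 ∂(P r) ≤ b')

/-- A (measurable, symmetric) bivariate kernel on the real line. -/
structure IsKernel (k : ℝ → ℝ → ℝ) : Prop where
  measurable : Measurable (Function.uncurry k)
  symm : ∀ x y, k x y = k y x

/-- The moments in the definition of `k_{st}(i)` and of the covariances of the `k_{st}(i)` exist: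
each `k(x_{si}, x_{ti})`, `s ≠ t`, is integrable and each `k_{st}(i)` is square integrable. -/
def KernelMoments {Ω : Type*} [MeasurableSpace Ω] {n p : ℕ} (μ : Measure Ω) (k : ℝ → ℝ → ℝ)
    (X : Fin n → Fin p → Ω → ℝ) : Prop :=
  ∀ (i : Fin p) (s t : Fin n), s ≠ t →
    Integrable (fun ω => k (X s i ω) (X t i ω)) μ ∧
    MemLp (fun ω => doubleCentered μ k (fun s => X s i) ω s t) 2 μ

/-- The vector `(p^{-1/2} ∑_i k_{st}(i))_{s<t}`. -/
def scaledSum {Ω : Type*} [MeasurableSpace Ω] {n p : ℕ} (μ : Measure Ω) (k : ℝ → ℝ → ℝ)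
    (X : Fin n → Fin p → Ω → ℝ) (ω : Ω) : IdxPair n → ℝ :=
  fun a => 1 / Real.sqrt (p : ℝ) *
    ∑ i : Fin p, doubleCentered μ k (fun s => X s i) ω a.1.1 a.1.2

/-- The joint Gaussian central limit assumption with limit `(c, d)` and constants
`σx2 = σ_x²`, `σy2 = σ_y²`, `σxy2 = σ_xy²`. The filter `atTop` on `ℕ × ℕ` is `p ∧ q → ∞`. -/
structure JointGaussianCLT {n : ℕ} {Ω : ℕ × ℕ → Type*} [∀ r, MeasurableSpace (Ω r)]
    (μ : (r : ℕ × ℕ) → Measure (Ω r)) [∀ r, IsProbabilityMeasure (μ r)] (k l : ℝ → ℝ → ℝ)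
    (X : (r : ℕ × ℕ) → Fin n → Fin r.1 → Ω r → ℝ)
    (Y : (r : ℕ × ℕ) → Fin n → Fin r.2 → Ω r → ℝ)
    {Ω' : Type*} [MeasurableSpace Ω'] (μ' : Measure Ω') [IsProbabilityMeasure μ']
    (c d : Ω' → IdxPair n → ℝ) (σx2 σy2 σxy2 : ℝ) : Prop where
  tendsto : TendstoInDistribution
    (fun r ω => (scaledSum (μ r) k (X r) ω, scaledSum (μ r) l (Y r) ω)) atTop
    (fun ω => (c ω, d ω)) μ μ'
  gaussian : IsGaussian (μ'.map fun ω => (c ω, d ω))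
  var_c : ∀ a, Var[fun ω => c ω a; μ'] = σx2
  var_d : ∀ a, Var[fun ω => d ω a; μ'] = σy2
  cov_cd : ∀ a, cov[fun ω => c ω a, fun ω => d ω a; μ'] = σxy2
  tendsto_x : ∀ a : IdxPair n, Tendsto (fun r : ℕ × ℕ => 1 / (r.1 : ℝ) *
    ∑ i : Fin r.1, ∑ j : Fin r.1,
      cov[fun ω => doubleCentered (μ r) k (fun s => X r s i) ω a.1.1 a.1.2,
        fun ω => doubleCentered (μ r) k (fun s => X r s j) ω a.1.1 a.1.2; μ r]) atTop (𝓝 σx2)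
  tendsto_y : ∀ a : IdxPair n, Tendsto (fun r : ℕ × ℕ => 1 / (r.2 : ℝ) *
    ∑ i : Fin r.2, ∑ j : Fin r.2,
      cov[fun ω => doubleCentered (μ r) l (fun s => Y r s i) ω a.1.1 a.1.2,
        fun ω => doubleCentered (μ r) l (fun s => Y r s j) ω a.1.1 a.1.2; μ r]) atTop (𝓝 σy2)
  tendsto_xy : ∀ a : IdxPair n, Tendsto (fun r : ℕ × ℕ =>
    1 / Real.sqrt ((r.1 : ℝ) * (r.2 : ℝ)) * ∑ i : Fin r.1, ∑ j : Fin r.2,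
      cov[fun ω => doubleCentered (μ r) k (fun s => X r s i) ω a.1.1 a.1.2,
        fun ω => doubleCentered (μ r) l (fun s => Y r s j) ω a.1.1 a.1.2; μ r]) atTop (𝓝 σxy2)

/-- The block matrix with blocks `σ_x² 𝐈`, `σ_xy² 𝐈`, `σ_xy² 𝐈`, `σ_y² 𝐈`. -/
def blockCov (n : ℕ) (σx2 σy2 σxy2 : ℝ) :
    Matrix (IdxPair n ⊕ IdxPair n) (IdxPair n ⊕ IdxPair n) ℝ :=
  Matrix.fromBlocks (σx2 • 1) (σxy2 • 1) (σxy2 • 1) (σy2 • 1)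

end

/-!
Entries of a double centered kernel matrix at distinct pairs of indices are uncorrelated, since some
observation occurs in only one of them and its conditional mean vanishes. In the limit, Fatou's
lemma bounds the second moment of a coordinate by the limit of the variances, which is its variance;
so the coordinate is centered. Applied to `V ± W`, the same bound identifies the covariances, so
`(c, d)` is Gaussian with covariance matrix `blockCov`.

`𝒰`-centering is idempotent on symmetric matrices with zero diagonal and its matrix `M` is
symmetric, so `M` is an orthogonal projection whose rank is its trace `v = n (n - 3) / 2`. Hence
`uCov` equals `v⁻¹ cᵀ M d` evaluated at the scaled sums, and the limits follow by continuous
mapping. Writing `M = Uᵀ U` with `U Uᵀ = 1` makes `cᵀ M c = ‖U c‖²` a sum of `v` squares of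
independent centered Gaussian variables.
-/

section UpperPart

variable {n : ℕ} {A B : Matrix (Fin n) (Fin n) ℝ}

/-- The upper triangular part `(a_{st})_{s<t}` of a square matrix, the coordinate vector of a
symmetric matrix with zero diagonal. -/
def upperPart (n : ℕ) : Matrix (Fin n) (Fin n) ℝ →ₗ[ℝ] IdxPair n → ℝ where
  toFun A a := A a.1.1 a.1.2
  map_add' _ _ := rfl
  map_smul' _ _ := rfl

lemma upperPart_apply (a : IdxPair n) : upperPart n A a = A a.1.1 a.1.2 := rfl

lemma eq_of_upperPart_eq (hA : A.IsSymm) (hA₀ : ∀ s, A s s = 0) (hB : B.IsSymm)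
    (hB₀ : ∀ s, B s s = 0) (h : upperPart n A = upperPart n B) : A = B := by
  ext s t
  rcases lt_trichotomy s t with hst | rfl | hts
  · exact congrFun h ⟨(s, t), hst⟩
  · rw [hA₀, hB₀]
  · rw [← hA.apply, ← hB.apply]
    exact congrFun h ⟨(t, s), hts⟩

/-- The symmetric matrix with zero diagonal whose upper triangular part is the unit vector at
`b`. -/
def symmSingle (b : IdxPair n) : Matrix (Fin n) (Fin n) ℝ :=
  Matrix.single b.1.1 b.1.2 1 + Matrix.single b.1.2 b.1.1 1

lemma symmSingle_apply (b : IdxPair n) (s t : Fin n) :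
    symmSingle b s t = (if b.1.1 = s ∧ b.1.2 = t then 1 else 0) +
      (if b.1.2 = s ∧ b.1.1 = t then 1 else 0) := rfl

lemma isSymm_symmSingle (b : IdxPair n) : (symmSingle b).IsSymm := by
  simp [Matrix.IsSymm, symmSingle, add_comm]

lemma symmSingle_diag (b : IdxPair n) (s : Fin n) : symmSingle b s s = 0 := by
  have := b.2.ne
  grind [symmSingle_apply]

lemma upperPart_symmSingle (b : IdxPair n) : upperPart n (symmSingle b) = Pi.single b 1 := by
  ext a
  simp only [upperPart_apply, symmSingle_apply, Pi.single_apply, Subtype.ext_iff, Prod.ext_iff]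
  grind [a.2, b.2]

lemma eq_sum_upperPart_smul_symmSingle (hA : A.IsSymm) (hA₀ : ∀ s, A s s = 0) :
    A = ∑ b, upperPart n A b • symmSingle b := by
  refine eq_of_upperPart_eq hA hA₀ ?_ (fun s => ?_) ?_
  · rw [Matrix.IsSymm, Matrix.transpose_sum]
    simp only [Matrix.transpose_smul, (isSymm_symmSingle _).eq]
  · simp [Matrix.sum_apply, symmSingle_diag]
  · simp only [map_sum, map_smul, upperPart_symmSingle]
    exact pi_eq_sum_univ' _

end UpperPart

section UCenter

variable {n : ℕ} {A B : Matrix (Fin n) (Fin n) ℝ}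

lemma uCenter_apply_of_ne (A : Matrix (Fin n) (Fin n) ℝ) {s t : Fin n} (hst : s ≠ t) :
    uCenter A s t = A s t - 1 / ((n : ℝ) - 2) * ∑ w, A s w - 1 / ((n : ℝ) - 2) * ∑ u, A u t
      + 1 / (((n : ℝ) - 1) * ((n : ℝ) - 2)) * ∑ u, ∑ w, A u w :=
  if_neg hst

lemma uCenter_diag (A : Matrix (Fin n) (Fin n) ℝ) (s : Fin n) : uCenter A s s = 0 := if_pos rfl

/-- `𝒰`-centering as a linear map. -/
noncomputable def uCenterLinear (n : ℕ) :
    Matrix (Fin n) (Fin n) ℝ →ₗ[ℝ] Matrix (Fin n) (Fin n) ℝ where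
  toFun := uCenter
  map_add' A B := by
    ext s t
    simp only [uCenter, Matrix.of_apply, Matrix.add_apply, Finset.sum_add_distrib]
    split_ifs <;> ring
  map_smul' c A := by
    ext s t
    simp only [uCenter, Matrix.of_apply, Matrix.smul_apply, smul_eq_mul, ← Finset.mul_sum,
      RingHom.id_apply]
    split_ifs <;> ring

lemma uCenterLinear_apply (A : Matrix (Fin n) (Fin n) ℝ) : uCenterLinear n A = uCenter A := rfl

lemma isSymm_uCenter (hA : A.IsSymm) : (uCenter A).IsSymm := by
  refine Matrix.IsSymm.ext fun s t => ?_
  have hcol (s : Fin n) : ∑ u, A u s = ∑ u, A s u := Finset.sum_congr rfl fun u _ => hA.apply s u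
  simp only [uCenter, Matrix.of_apply, hcol, eq_comm (a := t), hA.apply s t]
  split_ifs <;> ring

lemma sum_uCenter_row (hn : 3 ≤ n) (hA : A.IsSymm) (hA₀ : ∀ s, A s s = 0) (s : Fin n) :
    ∑ t, uCenter A s t = 0 := by
  have hn' : (3 : ℝ) ≤ n := by exact_mod_cast hn
  have h1 : (n : ℝ) - 1 ≠ 0 := by linarith
  have h2 : (n : ℝ) - 2 ≠ 0 := by linarith
  have hcol (t : Fin n) : ∑ u, A u t = ∑ u, A t u := Finset.sum_congr rfl fun u _ => hA.apply t u
  set T : ℝ := ∑ u, ∑ w, A u w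
  have hentry (t : Fin n) : uCenter A s t =
      (A s t - 1 / ((n : ℝ) - 2) * ∑ w, A s w - 1 / ((n : ℝ) - 2) * ∑ w, A t w
        + 1 / (((n : ℝ) - 1) * ((n : ℝ) - 2)) * T)
      - if s = t then - 2 / ((n : ℝ) - 2) * ∑ w, A s w + 1 / (((n : ℝ) - 1) * ((n : ℝ) - 2)) * T
        else 0 := by
    obtain rfl | hst := eq_or_ne s t
    · rw [uCenter_diag, hA₀, if_pos rfl]
      ring
    · rw [uCenter_apply_of_ne A hst, hcol, if_neg hst, sub_zero]
  calc ∑ t, uCenter A s t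
    _ = ∑ w, A s w - n * (1 / ((n : ℝ) - 2) * ∑ w, A s w) - 1 / ((n : ℝ) - 2) * T
          + n * (1 / (((n : ℝ) - 1) * ((n : ℝ) - 2)) * T)
        - (- 2 / ((n : ℝ) - 2) * ∑ w, A s w + 1 / (((n : ℝ) - 1) * ((n : ℝ) - 2)) * T) := by
      simp [hentry, Finset.sum_sub_distrib, Finset.sum_add_distrib, ← Finset.mul_sum, T]
    _ = 0 := by
      field_simp
      ring

lemma uCenter_uCenter (hn : 3 ≤ n) (hA : A.IsSymm) (hA₀ : ∀ s, A s s = 0) :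
    uCenter (uCenter A) = uCenter A := by
  have hrow := sum_uCenter_row hn hA hA₀
  have hcol (t : Fin n) : ∑ u, uCenter A u t = 0 := by
    simpa only [(isSymm_uCenter hA).apply] using hrow t
  ext s t
  obtain rfl | hst := eq_or_ne s t
  · rw [uCenter_diag, uCenter_diag]
  · rw [uCenter_apply_of_ne (uCenter A) hst]
    simp only [hrow, hcol, Finset.sum_const_zero, mul_zero, sub_zero, add_zero]

lemma sum_offDiag_eq_two_nsmul {ι M : Type*} [Fintype ι] [LinearOrder ι] [AddCommMonoid M]
    {F : ι → ι → M} (hF : ∀ s t, F s t = F t s) :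
    ∑ s, ∑ t, (if s = t then 0 else F s t) =
      2 • ∑ a : {a : ι × ι // a.1 < a.2}, F a.1.1 a.1.2 := by
  have hlt : ∑ a : {a : ι × ι // a.1 < a.2}, F a.1.1 a.1.2 =
      ∑ s, ∑ t, if s < t then F s t else 0 := by
    rw [← Fintype.sum_prod_type' (f := fun s t => if s < t then F s t else 0),
      ← Finset.sum_filter]
    exact (Finset.sum_subtype _ (by simp) fun a : ι × ι => F a.1 a.2).symm
  have hgt : ∑ s, ∑ t, (if s < t then F s t else 0) = ∑ s, ∑ t, if t < s then F s t else 0 := by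
    rw [Finset.sum_comm]
    simp only [hF]
  rw [two_nsmul, hlt]
  nth_rw 2 [hgt]
  simp only [← Finset.sum_add_distrib]
  refine Finset.sum_congr rfl fun s _ => Finset.sum_congr rfl fun t _ => ?_
  rcases lt_trichotomy s t with h | rfl | h
  · simp [h, h.ne, h.not_gt]
  · simp
  · simp [h, h.ne', h.not_gt]

lemma uInner_eq (hA : A.IsSymm) (hB : B.IsSymm) :
    uInner A B = 2 / ((n : ℝ) * ((n : ℝ) - 3)) * (upperPart n A ⬝ᵥ upperPart n B) := by
  rw [uInner, sum_offDiag_eq_two_nsmul fun s t => by rw [hA.apply t s, hB.apply t s], nsmul_eq_mul,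
    ← mul_assoc, one_div_mul_eq_div]
  rfl

end UCenter

section ProjMatrix

variable {n v : ℕ} {A B : Matrix (Fin n) (Fin n) ℝ}

lemma projMatrix_col (b : IdxPair n) :
    (projMatrix n).col b = upperPart n (uCenter (symmSingle b)) := rfl

lemma projMatrix_mulVec_upperPart (hA : A.IsSymm) (hA₀ : ∀ s, A s s = 0) :
    projMatrix n *ᵥ upperPart n A = upperPart n (uCenter A) := by
  conv_rhs => rw [eq_sum_upperPart_smul_symmSingle hA hA₀, ← uCenterLinear_apply]
  simp only [Matrix.mulVec_eq_sum, op_smul_eq_smul, map_sum, map_smul, uCenterLinear_apply]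
  rfl

lemma projMatrix_mul_self (hn : 3 ≤ n) : projMatrix n * projMatrix n = projMatrix n := by
  ext a b
  have hcol : projMatrix n *ᵥ (projMatrix n).col b = (projMatrix n).col b := by
    rw [projMatrix_col, projMatrix_mulVec_upperPart (isSymm_uCenter (isSymm_symmSingle b))
      (uCenter_diag _), uCenter_uCenter hn (isSymm_symmSingle b) (symmSingle_diag b)]
  exact congrFun hcol a

lemma projMatrix_apply (a b : IdxPair n) :
    projMatrix n a b = (if a = b then 1 else 0)
      - 1 / ((n : ℝ) - 2) * ((if a.1.1 = b.1.1 then 1 else 0) + (if a.1.1 = b.1.2 then 1 else 0)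
        + (if a.1.2 = b.1.1 then 1 else 0) + (if a.1.2 = b.1.2 then 1 else 0))
      + 2 / (((n : ℝ) - 1) * ((n : ℝ) - 2)) := by
  have hentry : symmSingle b a.1.1 a.1.2 = if a = b then 1 else 0 := by
    rw [← upperPart_apply (A := symmSingle b) a, upperPart_symmSingle, Pi.single_apply]
  have hrow (s : Fin n) : ∑ w, symmSingle b s w =
      (if s = b.1.1 then 1 else 0) + (if s = b.1.2 then 1 else 0) := by
    simp [symmSingle_apply, Finset.sum_add_distrib, ite_and, Finset.sum_ite_irrel, eq_comm]
  have hcol (t : Fin n) : ∑ u, symmSingle b u t =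
      (if t = b.1.1 then 1 else 0) + (if t = b.1.2 then 1 else 0) := by
    rw [← hrow t]
    simp only [(isSymm_symmSingle b).apply]
  change uCenter (symmSingle b) a.1.1 a.1.2 = _
  rw [uCenter_apply_of_ne _ a.2.ne, hentry]
  simp only [hrow, hcol, Finset.sum_add_distrib, Finset.sum_ite_eq', Finset.mem_univ, if_true]
  ring

lemma projMatrix_transpose (n : ℕ) : (projMatrix n)ᵀ = projMatrix n := by
  ext a b
  rw [Matrix.transpose_apply, projMatrix_apply, projMatrix_apply]
  simp only [eq_comm (a := b), eq_comm (a := b.1.1), eq_comm (a := b.1.2)]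
  ring

lemma two_mul_card_idxPair (n : ℕ) : 2 * (Fintype.card (IdxPair n) : ℝ) = n * ((n : ℝ) - 1) := by
  have hrow (s : Fin n) : ∑ t, (if s = t then (0 : ℝ) else 1) = n - 1 := by
    have hite (t : Fin n) : (if s = t then (0 : ℝ) else 1) = 1 - if s = t then 1 else 0 := by
      split_ifs <;> simp
    simp [hite]
  calc 2 * (Fintype.card (IdxPair n) : ℝ)
    _ = 2 • ∑ _a : IdxPair n, 1 := by simp
    _ = ∑ s : Fin n, ∑ t : Fin n, (if s = t then (0 : ℝ) else 1) :=
      (sum_offDiag_eq_two_nsmul (F := fun _ _ : Fin n => (1 : ℝ)) fun _ _ => rfl).symm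
    _ = n * ((n : ℝ) - 1) := by
      simp only [hrow, Finset.sum_const, Finset.card_univ, Fintype.card_fin, nsmul_eq_mul]

lemma projMatrix_trace (hn : 3 ≤ n) : 2 * (projMatrix n).trace = (n : ℝ) * ((n : ℝ) - 3) := by
  have hn' : (3 : ℝ) ≤ n := by exact_mod_cast hn
  have h1 : (n : ℝ) - 1 ≠ 0 := by linarith
  have h2 : (n : ℝ) - 2 ≠ 0 := by linarith
  have hdiag (a : IdxPair n) : projMatrix n a a = ((n : ℝ) - 3) / ((n : ℝ) - 1) := by
    simp only [projMatrix_apply, a.2.ne, a.2.ne', if_true, if_false]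
    field_simp
    ring
  simp only [Matrix.trace, Matrix.diag, hdiag, Finset.sum_const, Finset.card_univ, nsmul_eq_mul]
  rw [← mul_assoc, two_mul_card_idxPair]
  field_simp

lemma rank_eq_trace_of_isIdempotentElem {K ι : Type*} [Field K] [Fintype ι]
    {A : Matrix ι ι K} (hA : IsIdempotentElem A) : (A.rank : K) = A.trace := by
  classical
  have hA' : IsIdempotentElem (Matrix.toLin' A) := by
    rw [IsIdempotentElem, Module.End.mul_eq_comp, ← Matrix.toLin'_mul, hA]
  rw [← Matrix.trace_toLin'_eq, (LinearMap.IsIdempotentElem.isProj_range _ hA').trace]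
  rfl

lemma two_mul_natCast_half (hn : 3 ≤ n) (hv : v = n * (n - 3) / 2) :
    2 * (v : ℝ) = (n : ℝ) * ((n : ℝ) - 3) := by
  obtain ⟨m, rfl⟩ := Nat.exists_eq_add_of_le' hn
  have hv' : 2 * v = (m + 3) * m := by
    rw [hv, Nat.add_sub_cancel]
    refine Nat.mul_div_cancel' (even_iff_two_dvd.1 ?_)
    rcases Nat.even_or_odd m with h | h <;> simp [Nat.even_add, h, parity_simps]
  push_cast
  rw [add_sub_cancel_right]
  exact_mod_cast hv'

lemma projMatrix_rank (hn : 3 ≤ n) (hv : v = n * (n - 3) / 2) : (projMatrix n).rank = v := by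
  have hrank : ((projMatrix n).rank : ℝ) = v := by
    linarith [rank_eq_trace_of_isIdempotentElem (projMatrix_mul_self hn), projMatrix_trace hn,
      two_mul_natCast_half hn hv]
  exact_mod_cast hrank

lemma uInner_uCenter_uCenter (hn : 3 ≤ n) (hv : v = n * (n - 3) / 2) (hA : A.IsSymm)
    (hA₀ : ∀ s, A s s = 0) (hB : B.IsSymm) (hB₀ : ∀ s, B s s = 0) :
    uInner (uCenter A) (uCenter B) =
      1 / (v : ℝ) * (upperPart n A ⬝ᵥ (projMatrix n *ᵥ upperPart n B)) := by
  rw [uInner_eq (isSymm_uCenter hA) (isSymm_uCenter hB), ← projMatrix_mulVec_upperPart hA hA₀,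
    ← projMatrix_mulVec_upperPart hB hB₀, ← two_mul_natCast_half hn hv, Matrix.dotProduct_mulVec,
    Matrix.vecMul_mulVec, projMatrix_transpose, projMatrix_mul_self hn, ← Matrix.mulVec_transpose,
    projMatrix_transpose, Matrix.dotProduct_mulVec, ← Matrix.mulVec_transpose,
    projMatrix_transpose, div_mul_cancel_left₀ two_ne_zero, one_div]

end ProjMatrix

section CondExp

variable {Ω : Type*} {m mΩ : MeasurableSpace Ω} {μ : Measure Ω} {E F : Type*}
  {mE : MeasurableSpace E} {mF : MeasurableSpace F} {x : Ω → E} {y : Ω → F} {f : E → F → ℝ}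

lemma condExp_ae_eq_integral_map_of_indepFun [IsFiniteMeasure μ] [StandardBorelSpace F]
    [Nonempty F] (hx : Measurable x) (hy : Measurable y) (hxy : IndepFun x y μ)
    (hf : Measurable (Function.uncurry f)) (hint : Integrable (fun ω => f (x ω) (y ω)) μ) :
    μ[fun ω => f (x ω) (y ω) | MeasurableSpace.comap x mE] =ᵐ[μ]
      fun ω => ∫ b, f (x ω) b ∂(μ.map y) := by
  have hcond : condDistrib y x μ =ᵐ[μ.map x] Kernel.const E (μ.map y) := by
    refine condDistrib_ae_eq_of_measure_eq_compProd x hy.aemeasurable ?_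
    rw [Measure.compProd_const]
    exact (indepFun_iff_map_prod_eq_prod_map_map hx.aemeasurable hy.aemeasurable).1 hxy
  filter_upwards [condExp_prod_ae_eq_integral_condDistrib hx hy.aemeasurable hf.stronglyMeasurable
    hint, ae_of_ae_map hx.aemeasurable hcond] with ω hω hcond
  exact hω.trans (by rw [hcond, Kernel.const_apply]; rfl)

lemma condExp_ae_eq_integral_map_of_indep [IsFiniteMeasure μ] [StandardBorelSpace F] [Nonempty F]
    (hm : m ≤ mΩ) (hx : Measurable[m] x) (hy : Measurable y)
    (hindep : Indep m (MeasurableSpace.comap y mF) μ) (hf : Measurable (Function.uncurry f))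
    (hint : Integrable (fun ω => f (x ω) (y ω)) μ) :
    μ[fun ω => f (x ω) (y ω) | m] =ᵐ[μ] fun ω => ∫ b, f (x ω) b ∂(μ.map y) := by
  have hid : @IndepFun Ω Ω F mΩ m mF id y μ := by
    rwa [@IndepFun_iff_Indep, MeasurableSpace.comap_id]
  have h := condExp_ae_eq_integral_map_of_indepFun (mE := m) (f := fun ω b => f (x ω) b)
    (measurable_id'' hm) hy hid
    (hf.comp ((hx.comp measurable_fst).prodMk measurable_snd)) hint
  simpa only [MeasurableSpace.comap_id, id] using h

lemma condExp_ae_eq_condExp_comap_of_indep [IsFiniteMeasure μ] [StandardBorelSpace F] [Nonempty F]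
    (hm : m ≤ mΩ) (hx : Measurable[m] x) (hy : Measurable y)
    (hindep : Indep m (MeasurableSpace.comap y mF) μ) (hf : Measurable (Function.uncurry f))
    (hint : Integrable (fun ω => f (x ω) (y ω)) μ) :
    μ[fun ω => f (x ω) (y ω) | m] =ᵐ[μ]
      μ[fun ω => f (x ω) (y ω) | MeasurableSpace.comap x mE] :=
  (condExp_ae_eq_integral_map_of_indep hm hx hy hindep hf hint).trans
    (condExp_ae_eq_integral_map_of_indep (hx.comap_le.trans hm) (comap_measurable x) hy
      (indep_of_indep_of_le_left hindep hx.comap_le) hf hint).symm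

lemma covariance_eq_zero_of_condExp_ae_eq_zero [IsProbabilityMeasure μ] (hm : m ≤ mΩ)
    {g h : Ω → ℝ} (hg : MemLp g 2 μ) (hh : MemLp h 2 μ) (hg₀ : μ[g | m] =ᵐ[μ] 0)
    (hhm : StronglyMeasurable[m] h) : cov[g, h; μ] = 0 := by
  have hmean : μ[g] = 0 := by
    rw [← integral_condExp hm, integral_congr_ae hg₀]
    simp
  have hmul : μ[g * h] = 0 := by
    have hpull := condExp_mul_of_stronglyMeasurable_right hhm (hg.integrable_mul hh)
      (hg.integrable one_le_two)
    rw [← integral_condExp hm, integral_congr_ae hpull]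
    refine integral_eq_zero_of_ae ?_
    filter_upwards [hg₀] with ω hω
    simp [hω]
  rw [covariance_eq_sub hg hh, hmul, hmean, zero_mul, sub_zero]

lemma indep_iSup_ne_comap {ι : Type*} {D : ι → Ω → E} (hD : iIndepFun D μ)
    (hDm : ∀ s, Measurable (D s)) (t : ι) :
    Indep (⨆ s ∈ ({t}ᶜ : Set ι), MeasurableSpace.comap (D s) mE)
      (MeasurableSpace.comap (D t) mE) μ := by
  have h := indep_iSup_of_disjoint (fun s => (hDm s).comap_le) hD
    (disjoint_compl_left (a := ({t} : Set ι)))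
  simpa only [Set.mem_singleton_iff, iSup_iSup_eq_left] using h

end CondExp

section DoubleCentered

variable {Ω : Type*} {m mΩ : MeasurableSpace Ω} {μ : Measure Ω} {n : ℕ} {k l : ℝ → ℝ → ℝ}
  {x y : Fin n → Ω → ℝ} {s t u w : Fin n}

lemma doubleCentered_diag (ω : Ω) (s : Fin n) : doubleCentered μ k x ω s s = 0 := if_pos rfl

lemma doubleCentered_of_ne (hst : s ≠ t) :
    (fun ω => doubleCentered μ k x ω s t) = (fun ω => k (x s ω) (x t ω))
      - μ[fun ω => k (x s ω) (x t ω) | MeasurableSpace.comap (x s) inferInstance]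
      - μ[fun ω => k (x s ω) (x t ω) | MeasurableSpace.comap (x t) inferInstance]
      + fun _ => ∫ ω, k (x s ω) (x t ω) ∂μ :=
  funext fun _ => if_neg hst

lemma isSymm_doubleCentered (hk : ∀ a b, k a b = k b a) (ω : Ω) :
    (doubleCentered μ k x ω).IsSymm := by
  refine Matrix.IsSymm.ext fun s t => ?_
  simp only [doubleCentered, Matrix.of_apply, eq_comm (a := t), hk (x t _) (x s _)]
  split_ifs <;> ring

lemma stronglyMeasurable_doubleCentered (hk : Measurable (Function.uncurry k))
    (hs : Measurable[m] (x s)) (ht : Measurable[m] (x t)) :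
    StronglyMeasurable[m] fun ω => doubleCentered μ k x ω s t := by
  obtain rfl | hst := eq_or_ne s t
  · simp only [doubleCentered_diag]
    exact stronglyMeasurable_const
  · rw [doubleCentered_of_ne hst]
    exact (((hk.comp (hs.prodMk ht)).stronglyMeasurable.sub
      (stronglyMeasurable_condExp.mono hs.comap_le)).sub
      (stronglyMeasurable_condExp.mono ht.comap_le)).add stronglyMeasurable_const

variable [IsProbabilityMeasure μ]

lemma integral_doubleCentered (hs : Measurable (x s)) (ht : Measurable (x t))
    (hint : Integrable (fun ω => k (x s ω) (x t ω)) μ) :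
    ∫ ω, doubleCentered μ k x ω s t ∂μ = 0 := by
  obtain rfl | hst := eq_or_ne s t
  · simp only [doubleCentered_diag, integral_zero]
  · rw [doubleCentered_of_ne hst,
      integral_add' ((hint.sub integrable_condExp).sub integrable_condExp) (integrable_const _),
      integral_sub' (hint.sub integrable_condExp) integrable_condExp,
      integral_sub' hint integrable_condExp, integral_condExp hs.comap_le,
      integral_condExp ht.comap_le]
    simp

lemma condExp_doubleCentered_ae_eq_zero (hk : Measurable (Function.uncurry k)) (hst : s ≠ t)
    (hm : m ≤ mΩ) (hs : Measurable[m] (x s)) (ht : Measurable (x t))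
    (hindep : Indep m (MeasurableSpace.comap (x t) inferInstance) μ)
    (hint : Integrable (fun ω => k (x s ω) (x t ω)) μ) :
    μ[fun ω => doubleCentered μ k x ω s t | m] =ᵐ[μ] 0 := by
  rw [doubleCentered_of_ne hst]
  set g := μ[fun ω => k (x s ω) (x t ω) | MeasurableSpace.comap (x s) inferInstance]
  set h := μ[fun ω => k (x s ω) (x t ω) | MeasurableSpace.comap (x t) inferInstance]
  have hg : Integrable g μ := integrable_condExp
  have hh : Integrable h μ := integrable_condExp
  have hkernel : μ[fun ω => k (x s ω) (x t ω) | m] =ᵐ[μ] g :=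
    condExp_ae_eq_condExp_comap_of_indep hm hs ht hindep hk hint
  have hgm : μ[g | m] = g :=
    condExp_of_stronglyMeasurable hm (stronglyMeasurable_condExp.mono hs.comap_le) hg
  have hhm : μ[h | m] =ᵐ[μ] fun _ => ∫ ω, k (x s ω) (x t ω) ∂μ := by
    rw [← integral_condExp (μ := μ) (f := fun ω => k (x s ω) (x t ω)) ht.comap_le]
    exact condExp_indep_eq ht.comap_le hm stronglyMeasurable_condExp hindep.symm
  have hadd := condExp_add ((hint.sub hg).sub hh)
    (integrable_const (μ := μ) (∫ ω, k (x s ω) (x t ω) ∂μ)) m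
  rw [condExp_const hm] at hadd
  filter_upwards [hadd, condExp_sub (hint.sub hg) hh m, condExp_sub hint hg m, hkernel, hhm]
    with ω hadd hsub₁ hsub₂ hkernel hhm
  rw [hadd, Pi.add_apply, hsub₁, Pi.sub_apply, hsub₂, Pi.sub_apply, hkernel, hgm, hhm]
  simp

lemma covariance_doubleCentered_of_notMem (hxy : iIndepFun (fun s ω => (x s ω, y s ω)) μ)
    (hx : ∀ s, Measurable (x s)) (hy : ∀ s, Measurable (y s))
    (hk : Measurable (Function.uncurry k)) (hl : Measurable (Function.uncurry l))
    (hst : s ≠ t) (hut : u ≠ t) (hwt : w ≠ t)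
    (hint : Integrable (fun ω => k (x s ω) (x t ω)) μ)
    (hkx : MemLp (fun ω => doubleCentered μ k x ω s t) 2 μ)
    (hly : MemLp (fun ω => doubleCentered μ l y ω u w) 2 μ) :
    cov[fun ω => doubleCentered μ k x ω s t, fun ω => doubleCentered μ l y ω u w; μ] = 0 := by
  have hD (s : Fin n) : Measurable fun ω => (x s ω, y s ω) := (hx s).prodMk (hy s)
  set m : MeasurableSpace Ω :=
    ⨆ i ∈ ({t}ᶜ : Set (Fin n)), MeasurableSpace.comap (fun ω => (x i ω, y i ω)) inferInstance
  have hm : m ≤ mΩ := iSup₂_le fun i _ => (hD i).comap_le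
  have hDm {i : Fin n} (hi : i ≠ t) : Measurable[m] fun ω => (x i ω, y i ω) :=
    (comap_measurable _).mono (le_iSup₂_of_le i hi le_rfl) le_rfl
  have hindep : Indep m (MeasurableSpace.comap (x t) inferInstance) μ :=
    indep_of_indep_of_le_right (indep_iSup_ne_comap hxy hD t)
      (measurable_fst.comp (comap_measurable fun ω => (x t ω, y t ω))).comap_le
  exact covariance_eq_zero_of_condExp_ae_eq_zero hm hkx hly
    (condExp_doubleCentered_ae_eq_zero hk hst hm (measurable_fst.comp (hDm hst)) (hx t) hindep hint)
    (stronglyMeasurable_doubleCentered hl (measurable_snd.comp (hDm hut))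
      (measurable_snd.comp (hDm hwt)))

lemma covariance_doubleCentered_of_ne (hxy : iIndepFun (fun s ω => (x s ω, y s ω)) μ)
    (hx : ∀ s, Measurable (x s)) (hy : ∀ s, Measurable (y s)) (hk : IsKernel k)
    (hl : Measurable (Function.uncurry l)) {a b : IdxPair n} (hab : a ≠ b)
    (hint : Integrable (fun ω => k (x a.1.1 ω) (x a.1.2 ω)) μ)
    (hkx : MemLp (fun ω => doubleCentered μ k x ω a.1.1 a.1.2) 2 μ)
    (hly : MemLp (fun ω => doubleCentered μ l y ω b.1.1 b.1.2) 2 μ) :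
    cov[fun ω => doubleCentered μ k x ω a.1.1 a.1.2,
      fun ω => doubleCentered μ l y ω b.1.1 b.1.2; μ] = 0 := by
  have ha := a.2
  have hb := b.2
  have hcases : (b.1.1 ≠ a.1.2 ∧ b.1.2 ≠ a.1.2) ∨ (b.1.1 ≠ a.1.1 ∧ b.1.2 ≠ a.1.1) := by
    rw [ne_eq, Subtype.ext_iff, Prod.ext_iff] at hab
    grind
  rcases hcases with ⟨h₁, h₂⟩ | ⟨h₁, h₂⟩
  · exact covariance_doubleCentered_of_notMem hxy hx hy hk.measurable hl ha.ne h₁ h₂ hint hkx hly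
  · simp only [(isSymm_doubleCentered hk.symm _).apply a.1.2 a.1.1] at hkx ⊢
    simp only [hk.symm (x a.1.1 _)] at hint
    exact covariance_doubleCentered_of_notMem hxy hx hy hk.measurable hl ha.ne' h₁ h₂ hint hkx hly

end DoubleCentered

section ScaledSum

variable {Ω : Type*} [MeasurableSpace Ω] {μ : Measure Ω} {n p q : ℕ} {k l : ℝ → ℝ → ℝ}
  {X : Fin n → Fin p → Ω → ℝ} {Y : Fin n → Fin q → Ω → ℝ}

lemma scaledSum_eq_smul_sum_upperPart (ω : Ω) :
    scaledSum μ k X ω = (1 / √(p : ℝ)) •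
      ∑ i, upperPart n (doubleCentered μ k (fun s => X s i) ω) := by
  ext a
  simp only [scaledSum, Pi.smul_apply, Finset.sum_apply, smul_eq_mul, upperPart_apply]

lemma uCov_eq (hn : 3 ≤ n) {v : ℕ} (hv : v = n * (n - 3) / 2) (hk : ∀ x y, k x y = k y x)
    (hl : ∀ x y, l x y = l y x) (ω : Ω) :
    uCov μ k l X Y ω =
      1 / (v : ℝ) * (scaledSum μ k X ω ⬝ᵥ (projMatrix n *ᵥ scaledSum μ l Y ω)) := by
  have hinner (i : Fin p) (j : Fin q) :=
    uInner_uCenter_uCenter hn hv (isSymm_doubleCentered (μ := μ) (x := fun s => X s i) hk ω)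
      (doubleCentered_diag ω) (isSymm_doubleCentered (μ := μ) (x := fun s => Y s j) hl ω)
      (doubleCentered_diag ω)
  simp only [uCov, hinner, scaledSum_eq_smul_sum_upperPart, Matrix.mulVec_smul, Matrix.mulVec_sum,
    smul_dotProduct, dotProduct_smul, sum_dotProduct, dotProduct_sum, smul_eq_mul,
    Real.sqrt_mul (Nat.cast_nonneg p), ← Finset.mul_sum]
  rw [Finset.sum_comm]
  ring

lemma memLp_scaledSum (hkX : KernelMoments μ k X) (a : IdxPair n) :
    MemLp (fun ω => scaledSum μ k X ω a) 2 μ :=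
  (memLp_finsetSum _ fun i _ => (hkX i a.1.1 a.1.2 a.2.ne).2).const_mul _

lemma covariance_scaledSum [IsFiniteMeasure μ] (hkX : KernelMoments μ k X)
    (hlY : KernelMoments μ l Y) (a b : IdxPair n) :
    cov[fun ω => scaledSum μ k X ω a, fun ω => scaledSum μ l Y ω b; μ] =
      1 / √((p : ℝ) * (q : ℝ)) * ∑ i, ∑ j,
        cov[fun ω => doubleCentered μ k (fun s => X s i) ω a.1.1 a.1.2,
          fun ω => doubleCentered μ l (fun s => Y s j) ω b.1.1 b.1.2; μ] := by
  simp only [scaledSum]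
  rw [covariance_const_mul_left, covariance_const_mul_right,
    covariance_fun_sum_fun_sum (fun i => (hkX i a.1.1 a.1.2 a.2.ne).2)
      (fun j => (hlY j b.1.1 b.1.2 b.2.ne).2), Real.sqrt_mul (Nat.cast_nonneg p)]
  ring

variable [IsProbabilityMeasure μ]

lemma integral_scaledSum (hX : ∀ s i, Measurable (X s i)) (hkX : KernelMoments μ k X)
    (a : IdxPair n) : ∫ ω, scaledSum μ k X ω a ∂μ = 0 := by
  simp only [scaledSum]
  rw [integral_const_mul, integral_finsetSum _ fun i _ =>
    (hkX i a.1.1 a.1.2 a.2.ne).2.integrable one_le_two]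
  rw [Finset.sum_eq_zero fun i _ => integral_doubleCentered (x := fun s => X s i) (hX _ i) (hX _ i)
    (hkX i a.1.1 a.1.2 a.2.ne).1, mul_zero]

lemma covariance_scaledSum_of_ne (hX : ∀ s i, Measurable (X s i))
    (hY : ∀ s j, Measurable (Y s j))
    (hXY : iIndepFun (fun s ω => ((X s · ω), (Y s · ω))) μ)
    (hk : IsKernel k) (hl : Measurable (Function.uncurry l)) (hkX : KernelMoments μ k X)
    (hlY : KernelMoments μ l Y) {a b : IdxPair n} (hab : a ≠ b) :
    cov[fun ω => scaledSum μ k X ω a, fun ω => scaledSum μ l Y ω b; μ] = 0 := by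
  have hcoord (i : Fin p) (j : Fin q) : iIndepFun (fun s ω => (X s i ω, Y s j ω)) μ :=
    hXY.comp (fun _ (z : (Fin p → ℝ) × (Fin q → ℝ)) => (z.1 i, z.2 j)) fun _ => by fun_prop
  rw [covariance_scaledSum hkX hlY]
  simp only [covariance_doubleCentered_of_ne (hcoord _ _) (hX · _) (hY · _) hk hl hab
    (hkX _ a.1.1 a.1.2 a.2.ne).1 (hkX _ a.1.1 a.1.2 a.2.ne).2 (hlY _ b.1.1 b.1.2 b.2.ne).2,
    Finset.sum_const_zero, mul_zero]

end ScaledSum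

section ScaledSumLimit

variable {R : Type*} {F : Filter R} {Ω : R → Type*} [∀ r, MeasurableSpace (Ω r)]
  {μ : (r : R) → Measure (Ω r)} [∀ r, IsProbabilityMeasure (μ r)] {n : ℕ} {p q : R → ℕ}
  {k l : ℝ → ℝ → ℝ} {X : (r : R) → Fin n → Fin (p r) → Ω r → ℝ}
  {Y : (r : R) → Fin n → Fin (q r) → Ω r → ℝ} {σ : ℝ}

lemma tendsto_covariance_scaledSum (hX : ∀ r s i, Measurable (X r s i))
    (hY : ∀ r s j, Measurable (Y r s j))
    (hXY : ∀ r, iIndepFun (fun s ω => ((X r s · ω), (Y r s · ω))) (μ r))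
    (hk : IsKernel k) (hl : Measurable (Function.uncurry l))
    (hkX : ∀ r, KernelMoments (μ r) k (X r)) (hlY : ∀ r, KernelMoments (μ r) l (Y r))
    (hlim : ∀ a : IdxPair n, Tendsto (fun r => 1 / √((p r : ℝ) * (q r : ℝ)) * ∑ i, ∑ j,
      cov[fun ω => doubleCentered (μ r) k (fun s => X r s i) ω a.1.1 a.1.2,
        fun ω => doubleCentered (μ r) l (fun s => Y r s j) ω a.1.1 a.1.2; μ r]) F (𝓝 σ))
    (a b : IdxPair n) :
    Tendsto (fun r => cov[fun ω => scaledSum (μ r) k (X r) ω a,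
      fun ω => scaledSum (μ r) l (Y r) ω b; μ r]) F
      (𝓝 ((σ • (1 : Matrix (IdxPair n) (IdxPair n) ℝ)) a b)) := by
  obtain rfl | hab := eq_or_ne a b
  · simpa [covariance_scaledSum (hkX _) (hlY _)] using hlim a
  · simp only [covariance_scaledSum_of_ne (hX _) (hY _) (hXY _) hk hl (hkX _) (hlY _) hab,
      Matrix.smul_apply, Matrix.one_apply_ne hab, smul_zero]
    exact tendsto_const_nhds

lemma tendsto_covariance_scaledSum_self (hX : ∀ r s i, Measurable (X r s i))
    (hXX : ∀ r, iIndepFun (fun s ω => (X r s · ω)) (μ r)) (hk : IsKernel k)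
    (hkX : ∀ r, KernelMoments (μ r) k (X r))
    (hlim : ∀ a : IdxPair n, Tendsto (fun r => 1 / (p r : ℝ) * ∑ i, ∑ j,
      cov[fun ω => doubleCentered (μ r) k (fun s => X r s i) ω a.1.1 a.1.2,
        fun ω => doubleCentered (μ r) k (fun s => X r s j) ω a.1.1 a.1.2; μ r]) F (𝓝 σ))
    (a b : IdxPair n) :
    Tendsto (fun r => cov[fun ω => scaledSum (μ r) k (X r) ω a,
      fun ω => scaledSum (μ r) k (X r) ω b; μ r]) F
      (𝓝 ((σ • (1 : Matrix (IdxPair n) (IdxPair n) ℝ)) a b)) :=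
  tendsto_covariance_scaledSum hX hX
    (fun r => (hXX r).comp (fun _ (z : Fin (p r) → ℝ) => (z, z)) fun _ => by fun_prop) hk
    hk.measurable hkX hkX (by simpa only [Real.sqrt_mul_self (Nat.cast_nonneg _)] using hlim) a b

end ScaledSumLimit

section LimitMoments

variable {R : Type*} {F : Filter R} {Ω : R → Type*} [∀ r, MeasurableSpace (Ω r)]
  {μ : (r : R) → Measure (Ω r)} [∀ r, IsProbabilityMeasure (μ r)] {Ω' : Type*}
  [MeasurableSpace Ω'] {μ' : Measure Ω'}

lemma tendsto_integral_min_natCast {f : Ω' → ℝ} (hf : Integrable f μ') (hf₀ : ∀ ω, 0 ≤ f ω) :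
    Tendsto (fun K : ℕ => ∫ ω, min (f ω) K ∂μ') atTop (𝓝 (∫ ω, f ω ∂μ')) := by
  refine tendsto_integral_of_dominated_convergence f
    (fun K => hf.aestronglyMeasurable.inf aestronglyMeasurable_const) hf
    (fun K => ae_of_all _ fun ω => ?_) (ae_of_all _ fun ω => ?_)
  · rw [Real.norm_of_nonneg (le_min (hf₀ ω) K.cast_nonneg)]
    exact min_le_left _ _
  · obtain ⟨N, hN⟩ := exists_nat_ge (f ω)
    refine tendsto_const_nhds.congr' ?_
    filter_upwards [eventually_ge_atTop N] with K hK
    exact (min_eq_left (hN.trans (by exact_mod_cast hK))).symm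

lemma variance_add_const_mul [IsFiniteMeasure μ'] {X Y : Ω' → ℝ} (hX : MemLp X 2 μ')
    (hY : MemLp Y 2 μ') (ε : ℝ) :
    Var[fun ω => X ω + ε * Y ω; μ'] =
      Var[X; μ'] + 2 * ε * cov[X, Y; μ'] + ε ^ 2 * Var[Y; μ'] := by
  rw [variance_fun_add hX (hY.const_mul ε), variance_const_mul, covariance_const_mul_right]
  ring

variable [IsProbabilityMeasure μ']

lemma tendsto_integral_comp_of_tendstoInDistribution {E : Type*} [TopologicalSpace E]
    [MeasurableSpace E] [OpensMeasurableSpace E] {Z : (r : R) → Ω r → E} {W : Ω' → E}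
    (h : TendstoInDistribution Z F W μ μ') (f : BoundedContinuousFunction E ℝ) :
    Tendsto (fun r => ∫ ω, f (Z r ω) ∂(μ r)) F (𝓝 (∫ ω, f (W ω) ∂μ')) := by
  have hf : Measurable f := f.continuous.measurable
  have hlim := ProbabilityMeasure.tendsto_iff_forall_integral_tendsto.1 h.tendsto f
  simp only [ProbabilityMeasure.coe_mk] at hlim
  rw [integral_map h.aemeasurable_limit hf.aestronglyMeasurable] at hlim
  exact hlim.congr fun r => integral_map (h.forall_aemeasurable r) hf.aestronglyMeasurable

variable [F.NeBot]

lemma integral_norm_le_of_tendstoInDistribution {E : Type*} [NormedAddCommGroup E]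
    [MeasurableSpace E] [BorelSpace E] {Z : (r : R) → Ω r → E} {W : Ω' → E}
    (h : TendstoInDistribution Z F W μ μ') (hZ : ∀ r, Integrable (Z r) (μ r))
    (hW : Integrable W μ') {A : ℝ} (hA : Tendsto (fun r => ∫ ω, ‖Z r ω‖ ∂(μ r)) F (𝓝 A)) :
    ∫ ω, ‖W ω‖ ∂μ' ≤ A := by
  let truncatedNorm (K : ℕ) : BoundedContinuousFunction E ℝ :=
    BoundedContinuousFunction.ofNormedAddCommGroup (fun x => min ‖x‖ K) (by fun_prop) K fun x => by
      rw [Real.norm_of_nonneg (le_min (norm_nonneg x) K.cast_nonneg)]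
      exact min_le_right _ _
  refine le_of_tendsto' (tendsto_integral_min_natCast hW.norm fun ω => norm_nonneg _) fun K => ?_
  have hlim := tendsto_integral_comp_of_tendstoInDistribution h (truncatedNorm K)
  refine le_of_tendsto_of_tendsto' hlim hA fun r => ?_
  exact integral_mono ((hZ r).norm.inf (integrable_const _)) (hZ r).norm fun ω => min_le_left _ _

lemma integral_sq_le_of_tendsto_variance {Z : (r : R) → Ω r → ℝ} {W : Ω' → ℝ}
    (h : TendstoInDistribution Z F W μ μ') (hZ : ∀ r, MemLp (Z r) 2 (μ r)) (hW : MemLp W 2 μ')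
    (hZ₀ : ∀ r, ∫ ω, Z r ω ∂(μ r) = 0) {A : ℝ}
    (hA : Tendsto (fun r => Var[Z r; μ r]) F (𝓝 A)) : ∫ ω, W ω ^ 2 ∂μ' ≤ A := by
  have hsq := integral_norm_le_of_tendstoInDistribution (A := A)
    (h.continuous_comp (continuous_pow 2)) (fun r => (hZ r).integrable_sq) hW.integrable_sq
  simp only [Function.comp_apply, norm_pow, Real.norm_eq_abs, sq_abs] at hsq
  exact hsq (hA.congr fun r => variance_of_integral_eq_zero (hZ r).aemeasurable (hZ₀ r))

lemma variance_le_of_tendsto_variance {Z : (r : R) → Ω r → ℝ} {W : Ω' → ℝ}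
    (h : TendstoInDistribution Z F W μ μ') (hZ : ∀ r, MemLp (Z r) 2 (μ r)) (hW : MemLp W 2 μ')
    (hZ₀ : ∀ r, ∫ ω, Z r ω ∂(μ r) = 0) {A : ℝ}
    (hA : Tendsto (fun r => Var[Z r; μ r]) F (𝓝 A)) : Var[W; μ'] ≤ A :=
  (variance_le_expectation_sq hW.aestronglyMeasurable).trans
    (integral_sq_le_of_tendsto_variance h hZ hW hZ₀ hA)

lemma integral_eq_zero_of_tendsto_variance {Z : (r : R) → Ω r → ℝ} {W : Ω' → ℝ}
    (h : TendstoInDistribution Z F W μ μ') (hZ : ∀ r, MemLp (Z r) 2 (μ r)) (hW : MemLp W 2 μ')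
    (hZ₀ : ∀ r, ∫ ω, Z r ω ∂(μ r) = 0)
    (hvar : Tendsto (fun r => Var[Z r; μ r]) F (𝓝 Var[W; μ'])) : ∫ ω, W ω ∂μ' = 0 := by
  have hle := integral_sq_le_of_tendsto_variance h hZ hW hZ₀ hvar
  have heq : Var[W; μ'] = ∫ ω, W ω ^ 2 ∂μ' - (∫ ω, W ω ∂μ') ^ 2 := variance_eq_sub hW
  exact pow_eq_zero_iff two_ne_zero |>.1 (le_antisymm (by linarith) (sq_nonneg _))

lemma covariance_eq_of_tendsto_covariance {S T : (r : R) → Ω r → ℝ} {V W : Ω' → ℝ} {C : ℝ}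
    (h : TendstoInDistribution (fun r ω => (S r ω, T r ω)) F (fun ω => (V ω, W ω)) μ μ')
    (hS : ∀ r, MemLp (S r) 2 (μ r)) (hT : ∀ r, MemLp (T r) 2 (μ r)) (hV : MemLp V 2 μ')
    (hW : MemLp W 2 μ') (hS₀ : ∀ r, ∫ ω, S r ω ∂(μ r) = 0) (hT₀ : ∀ r, ∫ ω, T r ω ∂(μ r) = 0)
    (hvarS : Tendsto (fun r => Var[S r; μ r]) F (𝓝 Var[V; μ']))
    (hvarT : Tendsto (fun r => Var[T r; μ r]) F (𝓝 Var[W; μ']))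
    (hcov : Tendsto (fun r => cov[S r, T r; μ r]) F (𝓝 C)) : cov[V, W; μ'] = C := by
  have hle (ε : ℝ) : ε * cov[V, W; μ'] ≤ ε * C := by
    have hlim : Tendsto (fun r => Var[fun ω => S r ω + ε * T r ω; μ r]) F
        (𝓝 (Var[V; μ'] + 2 * ε * C + ε ^ 2 * Var[W; μ'])) := by
      simp only [variance_add_const_mul (hS _) (hT _)]
      exact (hvarS.add (hcov.const_mul _)).add (hvarT.const_mul _)
    have hmean (r : R) : ∫ ω, S r ω + ε * T r ω ∂(μ r) = 0 := by
      rw [integral_add ((hS r).integrable one_le_two) (((hT r).integrable one_le_two).const_mul ε),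
        integral_const_mul, hS₀, hT₀, mul_zero, add_zero]
    have hvar := variance_le_of_tendsto_variance
      (h.continuous_comp (g := fun z : ℝ × ℝ => z.1 + ε * z.2) (by fun_prop))
      (fun r => (hS r).add ((hT r).const_mul ε)) (hV.add (hW.const_mul ε)) hmean hlim
    have hexpand := variance_add_const_mul hV hW ε
    simp only [Function.comp_def] at hvar
    linarith
  linarith [hle 1, hle (-1)]

variable {ι : Type*} [Finite ι] {Z : (r : R) → Ω r → ι → ℝ} {W : Ω' → ι → ℝ} {C : Matrix ι ι ℝ}

lemma integral_apply_eq_zero_of_tendsto_covariance (h : TendstoInDistribution Z F W μ μ')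
    (hZ : ∀ r i, MemLp (fun ω => Z r ω i) 2 (μ r)) (hW : ∀ i, MemLp (fun ω => W ω i) 2 μ')
    (hZ₀ : ∀ r i, ∫ ω, Z r ω i ∂(μ r) = 0) (hvar : ∀ i, Var[fun ω => W ω i; μ'] = C i i)
    (hcov : ∀ i j, Tendsto (fun r => cov[fun ω => Z r ω i, fun ω => Z r ω j; μ r]) F (𝓝 (C i j)))
    (i : ι) : ∫ ω, W ω i ∂μ' = 0 := by
  refine integral_eq_zero_of_tendsto_variance (W := fun ω => W ω i)
    (h.continuous_comp (continuous_apply i)) (hZ · i) (hW i) (hZ₀ · i) ?_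
  rw [hvar]
  exact (hcov i i).congr fun r => covariance_self (hZ r i).aemeasurable

lemma covariance_apply_eq_of_tendsto_covariance (h : TendstoInDistribution Z F W μ μ')
    (hZ : ∀ r i, MemLp (fun ω => Z r ω i) 2 (μ r)) (hW : ∀ i, MemLp (fun ω => W ω i) 2 μ')
    (hZ₀ : ∀ r i, ∫ ω, Z r ω i ∂(μ r) = 0) (hvar : ∀ i, Var[fun ω => W ω i; μ'] = C i i)
    (hcov : ∀ i j, Tendsto (fun r => cov[fun ω => Z r ω i, fun ω => Z r ω j; μ r]) F (𝓝 (C i j)))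
    (i j : ι) : cov[fun ω => W ω i, fun ω => W ω j; μ'] = C i j := by
  have htendsto (i : ι) :
      Tendsto (fun r => Var[fun ω => Z r ω i; μ r]) F (𝓝 Var[fun ω => W ω i; μ']) := by
    rw [hvar]
    exact (hcov i i).congr fun r => covariance_self (hZ r i).aemeasurable
  exact covariance_eq_of_tendsto_covariance
    (h.continuous_comp ((continuous_apply i).prodMk (continuous_apply j))) (hZ · i) (hZ · j)
    (hW i) (hW j) (hZ₀ · i) (hZ₀ · j) (htendsto i) (htendsto j) (hcov i j)

end LimitMoments

section GaussianLaw

variable {Ω' : Type*} [MeasurableSpace Ω'] {μ' : Measure Ω'} {ι : Type*}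
  {Z : Ω' → ι → ℝ} {S : Matrix ι ι ℝ}

lemma covariance_mulVec [Fintype ι] {κ : Type*} [IsFiniteMeasure μ']
    (hZ : ∀ i, MemLp (fun ω => Z ω i) 2 μ')
    (hcov : ∀ i j, cov[fun ω => Z ω i, fun ω => Z ω j; μ'] = S i j) (U : Matrix κ ι ℝ) (a b : κ) :
    cov[fun ω => (U *ᵥ Z ω) a, fun ω => (U *ᵥ Z ω) b; μ'] = (U * S * Uᵀ) a b := by
  simp only [Matrix.mulVec, dotProduct]
  rw [covariance_fun_sum_fun_sum (fun i => (hZ i).const_mul (U a i))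
    (fun j => (hZ j).const_mul (U b j))]
  simp only [covariance_const_mul_left, covariance_const_mul_right, hcov, Matrix.mul_apply,
    Matrix.transpose_apply, Finset.sum_mul]
  rw [Finset.sum_comm]
  exact Finset.sum_congr rfl fun j _ => Finset.sum_congr rfl fun i _ => by ring

lemma covarianceBilin_map_toLp [Fintype ι] [IsFiniteMeasure μ']
    (hZ : ∀ i, MemLp (fun ω => Z ω i) 2 μ')
    (hcov : ∀ i j, cov[fun ω => Z ω i, fun ω => Z ω j; μ'] = S i j) (x y : EuclideanSpace ℝ ι) :
    covarianceBilin (μ'.map fun ω => WithLp.toLp 2 (Z ω)) x y = x ⬝ᵥ (S *ᵥ y) := by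
  rw [covarianceBilin_apply_pi hZ]
  simp only [hcov, dotProduct, Matrix.mulVec, Finset.mul_sum]
  exact Finset.sum_congr rfl fun i _ => Finset.sum_congr rfl fun j _ => by ring

lemma posSemidef_of_covariance [Finite ι] [IsFiniteMeasure μ']
    (hZ : ∀ i, MemLp (fun ω => Z ω i) 2 μ')
    (hcov : ∀ i j, cov[fun ω => Z ω i, fun ω => Z ω j; μ'] = S i j) : S.PosSemidef := by
  have := Fintype.ofFinite ι
  refine Matrix.PosSemidef.of_dotProduct_mulVec_nonneg ?_ fun x => ?_
  · ext i j
    rw [Matrix.conjTranspose_apply, star_trivial, ← hcov, ← hcov, covariance_comm]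
  · rw [star_trivial, ← covarianceBilin_map_toLp hZ hcov (WithLp.toLp 2 x) (WithLp.toLp 2 x)]
    exact covarianceBilin_self_nonneg _

lemma hasLaw_multivariateGaussian [Fintype ι] [DecidableEq ι] (hZ : HasGaussianLaw Z μ')
    (hmean : ∀ i, ∫ ω, Z ω i ∂μ' = 0)
    (hcov : ∀ i j, cov[fun ω => Z ω i, fun ω => Z ω j; μ'] = S i j) :
    HasLaw (fun ω => WithLp.toLp 2 (Z ω)) (multivariateGaussian 0 S) μ' := by
  have := hZ.isProbabilityMeasure
  have hi (i : ι) : MemLp (fun ω => Z ω i) 2 μ' := (hZ.eval i).memLp_two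
  have hG : HasGaussianLaw (fun ω => WithLp.toLp 2 (Z ω)) μ' := hZ.toLp_pi 2
  have := hG.isGaussian_map
  refine ⟨hG.aemeasurable, IsGaussian.ext ?_ ?_⟩
  · rw [integral_id_multivariateGaussian', integral_map hG.aemeasurable (by fun_prop)]
    ext i
    have hproj := (EuclideanSpace.proj (𝕜 := ℝ) i).integral_comp_comm hG.integrable
    exact hproj.symm.trans (by simpa using hmean i)
  · ext x y
    rw [covarianceBilin_multivariateGaussian (posSemidef_of_covariance hi hcov),
      covarianceBilin_map_toLp hi hcov]

lemma hasLaw_pi_gaussianReal [Fintype ι] [DecidableEq ι] {σ2 : ℝ} (hZ : HasGaussianLaw Z μ')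
    (hmean : ∀ i, ∫ ω, Z ω i ∂μ' = 0)
    (hcov : ∀ i j, cov[fun ω => Z ω i, fun ω => Z ω j; μ'] = (σ2 • (1 : Matrix ι ι ℝ)) i j) :
    HasLaw Z (Measure.pi fun _ => gaussianReal 0 σ2.toNNReal) μ' := by
  have hind : iIndepFun (fun i ω => Z ω i) μ' :=
    HasGaussianLaw.iIndepFun_of_covariance_eq_zero (X := fun i ω => Z ω i) hZ fun i j hij => by
      rw [hcov, Matrix.smul_apply, Matrix.one_apply_ne hij, smul_zero]
  refine hind.hasLaw_pi fun i => ⟨(hZ.eval i).aemeasurable, ?_⟩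
  have hvar : Var[fun ω => Z ω i; μ'] = σ2 := by
    rw [← covariance_self (hZ.eval i).aemeasurable, hcov]
    simp
  rw [(hZ.eval i).map_eq_gaussianReal, hmean, hvar]

lemma map_sum_sq_pi_gaussianReal {σ2 : ℝ} (hσ : 0 ≤ σ2) (v : ℕ) :
    (Measure.pi fun _ : Fin v => gaussianReal 0 σ2.toNNReal).map (fun z => ∑ i, z i ^ 2) =
      (chiSquare v).map (σ2 * ·) := by
  have hscale : gaussianReal 0 σ2.toNNReal = (gaussianReal 0 1).map (√σ2 * ·) := by
    rw [gaussianReal_map_const_mul]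
    congr 1
    · simp
    · ext
      simp [Real.sq_sqrt hσ, hσ]
  rw [hscale, ← Measure.pi_map_pi fun _ => by fun_prop, chiSquare,
    Measure.map_map (by fun_prop) (by fun_prop), Measure.map_map (by fun_prop) (by fun_prop)]
  congr 1
  ext z
  simp only [Function.comp_apply, mul_pow, Real.sq_sqrt hσ, Finset.mul_sum]

end GaussianLaw

section QuadraticForm

variable {ι : Type*} [Fintype ι] {M : Matrix ι ι ℝ} {v : ℕ}

lemma starProjection_range_toEuclideanLin [DecidableEq ι] (hT : Mᵀ = M) (hM : M * M = M)
    (x : ι → ℝ) :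
    (Matrix.toEuclideanLin M).range.starProjection (WithLp.toLp 2 x) = WithLp.toLp 2 (M *ᵥ x) := by
  refine Submodule.eq_starProjection_of_mem_of_inner_eq_zero
    (LinearMap.mem_range.2 ⟨WithLp.toLp 2 x, rfl⟩) ?_
  rintro _ ⟨y, rfl⟩
  change inner ℝ (WithLp.toLp 2 (x - M *ᵥ x)) (WithLp.toLp 2 (M *ᵥ WithLp.ofLp y)) = 0
  rw [EuclideanSpace.inner_toLp_toLp, star_trivial, dotProduct_comm, Matrix.dotProduct_mulVec,
    ← Matrix.mulVec_transpose, hT, Matrix.mulVec_sub, Matrix.mulVec_mulVec, hM, sub_self,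
    zero_dotProduct]

lemma exists_transpose_mul_mulVec_eq_starProjection (K : Submodule ℝ (EuclideanSpace ℝ ι))
    (hK : Module.finrank ℝ K = v) : ∃ U : Matrix (Fin v) ι ℝ, U * Uᵀ = 1 ∧
      ∀ x, WithLp.toLp 2 ((Uᵀ * U) *ᵥ x) = K.starProjection (WithLp.toLp 2 x) := by
  let b := (stdOrthonormalBasis ℝ K).reindex (finCongr hK)
  let U : Matrix (Fin v) ι ℝ := Matrix.of fun i => WithLp.ofLp (b i : EuclideanSpace ℝ ι)
  have hinner (i : Fin v) (x : ι → ℝ) :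
      inner ℝ (b i : EuclideanSpace ℝ ι) (WithLp.toLp 2 x) = (U *ᵥ x) i := by
    rw [EuclideanSpace.inner_eq_star_dotProduct, star_trivial, dotProduct_comm]
    rfl
  refine ⟨U, ?_, fun x => ?_⟩
  · ext i j
    rw [Matrix.one_apply, ← orthonormal_iff_ite.1 b.orthonormal i j]
    exact (hinner i (U j)).symm
  · ext a
    rw [b.starProjection_eq_sum_rankOne, ← Matrix.mulVec_mulVec]
    simp [hinner, Matrix.mulVec, dotProduct, U, mul_comm]

lemma exists_mul_transpose_eq_one_and_transpose_mul_eq (hT : Mᵀ = M) (hM : M * M = M)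
    (hv : M.rank = v) : ∃ U : Matrix (Fin v) ι ℝ, U * Uᵀ = 1 ∧ Uᵀ * U = M := by
  classical
  have hrange : Module.finrank ℝ (Matrix.toEuclideanLin M).range = v := by
    rw [← hv, Matrix.rank_eq_finrank_range_toLin M (EuclideanSpace.basisFun ι ℝ).toBasis
      (EuclideanSpace.basisFun ι ℝ).toBasis]
    rfl
  obtain ⟨U, hU, hproj⟩ := exists_transpose_mul_mulVec_eq_starProjection _ hrange
  refine ⟨U, hU, Matrix.mulVec_injective (funext fun x => WithLp.toLp_injective 2 ?_)⟩
  rw [hproj, starProjection_range_toEuclideanLin hT hM]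

variable {Ω' : Type*} [MeasurableSpace Ω'] {μ' : Measure Ω'} {Z : Ω' → ι → ℝ} {σ2 : ℝ}

lemma hasLaw_chiSquare_quadraticForm [DecidableEq ι] (hT : Mᵀ = M) (hM : M * M = M)
    (hv : M.rank = v) (hZ : HasGaussianLaw Z μ') (hσ : 0 ≤ σ2) (hmean : ∀ i, ∫ ω, Z ω i ∂μ' = 0)
    (hcov : ∀ i j, cov[fun ω => Z ω i, fun ω => Z ω j; μ'] = (σ2 • (1 : Matrix ι ι ℝ)) i j) :
    HasLaw (fun ω => 1 / (v : ℝ) * (Z ω ⬝ᵥ (M *ᵥ Z ω)))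
      ((chiSquare v).map fun z => σ2 / (v : ℝ) * z) μ' := by
  have := hZ.isProbabilityMeasure
  obtain ⟨U, hUU, rfl⟩ := exists_mul_transpose_eq_one_and_transpose_mul_eq hT hM hv
  have hi (i : ι) : MemLp (fun ω => Z ω i) 2 μ' := (hZ.eval i).memLp_two
  have hUZ : HasLaw (fun ω => U *ᵥ Z ω) (Measure.pi fun _ => gaussianReal 0 σ2.toNNReal) μ' := by
    refine hasLaw_pi_gaussianReal (hZ.map_fun (LinearMap.toContinuousLinearMap U.mulVecLin))
      (fun a => ?_) fun a b => ?_
    · change ∫ ω, ∑ i, U a i * Z ω i ∂μ' = 0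
      rw [integral_finsetSum _ fun i _ => ((hi i).integrable one_le_two).const_mul _]
      simp only [integral_const_mul, hmean, mul_zero, Finset.sum_const_zero]
    · refine (covariance_mulVec hi hcov U a b).trans ?_
      rw [Matrix.mul_smul, Matrix.mul_one, Matrix.smul_mul, hUU]
  have hsq : HasLaw (fun z : Fin v → ℝ => ∑ i, z i ^ 2) ((chiSquare v).map (σ2 * ·))
      (Measure.pi fun _ => gaussianReal 0 σ2.toNNReal) :=
    ⟨Measurable.aemeasurable (by fun_prop), map_sum_sq_pi_gaussianReal hσ v⟩
  have hscale : HasLaw (fun z : ℝ => 1 / (v : ℝ) * z)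
      ((chiSquare v).map fun z => σ2 / (v : ℝ) * z) ((chiSquare v).map (σ2 * ·)) := by
    refine ⟨by fun_prop, ?_⟩
    rw [Measure.map_map (by fun_prop) (by fun_prop)]
    congr 1
    ext z
    simp only [Function.comp_apply]
    ring
  refine (hscale.fun_comp (hsq.fun_comp hUZ)).congr (ae_of_all _ fun ω => ?_)
  simp only [sq]
  rw [← Matrix.mulVec_mulVec, Matrix.dotProduct_mulVec, Matrix.vecMul_transpose, dotProduct]

end QuadraticForm

section JointLimit

variable {R : Type*} {F : Filter R} {Ω : R → Type*} [∀ r, MeasurableSpace (Ω r)]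
  {μ : (r : R) → Measure (Ω r)} [∀ r, IsProbabilityMeasure (μ r)] {n : ℕ} {p q : R → ℕ}
  {k l : ℝ → ℝ → ℝ} {X : (r : R) → Fin n → Fin (p r) → Ω r → ℝ}
  {Y : (r : R) → Fin n → Fin (q r) → Ω r → ℝ} {Ω' : Type*} [MeasurableSpace Ω']
  {μ' : Measure Ω'} {c d : Ω' → IdxPair n → ℝ} {σx2 σy2 σxy2 : ℝ}

lemma hasGaussianLaw_sumElim {ι κ : Type*} [Finite ι] [Finite κ] {U : Ω' → ι → ℝ}
    {V : Ω' → κ → ℝ} (h : HasGaussianLaw (fun ω => (U ω, V ω)) μ') :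
    HasGaussianLaw (fun ω => Sum.elim (U ω) (V ω)) μ' := by
  have := Fintype.ofFinite ι
  have := Fintype.ofFinite κ
  exact h.map_fun (LinearMap.toContinuousLinearMap
    (LinearEquiv.sumArrowLequivProdArrow ι κ ℝ ℝ).symm.toLinearMap)

lemma tendsto_covariance_sumElim_scaledSum (hX : ∀ r s i, Measurable (X r s i))
    (hY : ∀ r s j, Measurable (Y r s j))
    (hXY : ∀ r, iIndepFun (fun s ω => ((X r s · ω), (Y r s · ω))) (μ r))
    (hk : IsKernel k) (hl : IsKernel l)
    (hkX : ∀ r, KernelMoments (μ r) k (X r)) (hlY : ∀ r, KernelMoments (μ r) l (Y r))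
    (hlimx : ∀ a : IdxPair n, Tendsto (fun r => 1 / (p r : ℝ) * ∑ i, ∑ j,
      cov[fun ω => doubleCentered (μ r) k (fun s => X r s i) ω a.1.1 a.1.2,
        fun ω => doubleCentered (μ r) k (fun s => X r s j) ω a.1.1 a.1.2; μ r]) F (𝓝 σx2))
    (hlimy : ∀ a : IdxPair n, Tendsto (fun r => 1 / (q r : ℝ) * ∑ i, ∑ j,
      cov[fun ω => doubleCentered (μ r) l (fun s => Y r s i) ω a.1.1 a.1.2,
        fun ω => doubleCentered (μ r) l (fun s => Y r s j) ω a.1.1 a.1.2; μ r]) F (𝓝 σy2))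
    (hlimxy : ∀ a : IdxPair n, Tendsto (fun r => 1 / √((p r : ℝ) * (q r : ℝ)) * ∑ i, ∑ j,
      cov[fun ω => doubleCentered (μ r) k (fun s => X r s i) ω a.1.1 a.1.2,
        fun ω => doubleCentered (μ r) l (fun s => Y r s j) ω a.1.1 a.1.2; μ r]) F (𝓝 σxy2))
    (a b : IdxPair n ⊕ IdxPair n) :
    Tendsto (fun r =>
      cov[fun ω => Sum.elim (scaledSum (μ r) k (X r) ω) (scaledSum (μ r) l (Y r) ω) a,
        fun ω => Sum.elim (scaledSum (μ r) k (X r) ω) (scaledSum (μ r) l (Y r) ω) b; μ r]) F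
      (𝓝 (blockCov n σx2 σy2 σxy2 a b)) := by
  have hXX (r : R) : iIndepFun (fun s ω => (X r s · ω)) (μ r) :=
    (hXY r).comp (fun _ => Prod.fst) fun _ => measurable_fst
  have hYY (r : R) : iIndepFun (fun s ω => (Y r s · ω)) (μ r) :=
    (hXY r).comp (fun _ => Prod.snd) fun _ => measurable_snd
  have hxy := tendsto_covariance_scaledSum hX hY hXY hk hl.measurable hkX hlY hlimxy
  rcases a with a | a <;> rcases b with b | b
  · exact tendsto_covariance_scaledSum_self hX hXX hk hkX hlimx a b
  · exact hxy a b
  · rw [show blockCov n σx2 σy2 σxy2 (.inr a) (.inl b) =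
      (σxy2 • (1 : Matrix (IdxPair n) (IdxPair n) ℝ)) b a by
        simp [blockCov, Matrix.one_apply, eq_comm]]
    exact (hxy b a).congr fun r => covariance_comm _ _
  · exact tendsto_covariance_scaledSum_self hY hYY hl hlY hlimy a b

lemma tendstoInDistribution_uCov [IsProbabilityMeasure μ'] (hn : 3 ≤ n) {v : ℕ}
    (hv : v = n * (n - 3) / 2) (hk : IsKernel k) (hl : IsKernel l)
    (h : TendstoInDistribution (fun r ω => (scaledSum (μ r) k (X r) ω, scaledSum (μ r) l (Y r) ω))
      F (fun ω => (c ω, d ω)) μ μ') :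
    TendstoInDistribution (fun r => uCov (μ r) k l (X r) (Y r)) F
      (fun ω => 1 / (v : ℝ) * (c ω ⬝ᵥ (projMatrix n *ᵥ d ω))) μ μ' := by
  rw [show (fun r => uCov (μ r) k l (X r) (Y r)) = _ from
    funext fun r => funext fun ω => uCov_eq hn hv hk.symm hl.symm ω]
  exact h.continuous_comp (g := fun z : (IdxPair n → ℝ) × (IdxPair n → ℝ) =>
    1 / (v : ℝ) * (z.1 ⬝ᵥ (projMatrix n *ᵥ z.2))) (by fun_prop)

variable [F.NeBot] [IsProbabilityMeasure μ']

lemma integral_eq_zero_and_covariance_eq_blockCov (hX : ∀ r s i, Measurable (X r s i))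
    (hY : ∀ r s j, Measurable (Y r s j))
    (hkX : ∀ r, KernelMoments (μ r) k (X r)) (hlY : ∀ r, KernelMoments (μ r) l (Y r))
    (hlim : TendstoInDistribution
      (fun r ω => (scaledSum (μ r) k (X r) ω, scaledSum (μ r) l (Y r) ω)) F
      (fun ω => (c ω, d ω)) μ μ')
    (hc : ∀ a, MemLp (fun ω => c ω a) 2 μ') (hd : ∀ a, MemLp (fun ω => d ω a) 2 μ')
    (hvarc : ∀ a, Var[fun ω => c ω a; μ'] = σx2) (hvard : ∀ a, Var[fun ω => d ω a; μ'] = σy2)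
    (hcov : ∀ a b, Tendsto (fun r =>
      cov[fun ω => Sum.elim (scaledSum (μ r) k (X r) ω) (scaledSum (μ r) l (Y r) ω) a,
        fun ω => Sum.elim (scaledSum (μ r) k (X r) ω) (scaledSum (μ r) l (Y r) ω) b; μ r]) F
      (𝓝 (blockCov n σx2 σy2 σxy2 a b))) :
    (∀ a, ∫ ω, Sum.elim (c ω) (d ω) a ∂μ' = 0) ∧
      ∀ a b, cov[fun ω => Sum.elim (c ω) (d ω) a, fun ω => Sum.elim (c ω) (d ω) b; μ'] =
        blockCov n σx2 σy2 σxy2 a b := by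
  have hlim' := hlim.continuous_comp (g := fun z => (Sum.elim z.1 z.2 : IdxPair n ⊕ IdxPair n → ℝ))
    (continuous_pi (Sum.rec (fun a => (continuous_apply a).comp continuous_fst)
        fun a => (continuous_apply a).comp continuous_snd))
  have hmemLp (r : R) : ∀ a, MemLp (fun ω => Sum.elim (scaledSum (μ r) k (X r) ω)
      (scaledSum (μ r) l (Y r) ω) a) 2 (μ r) :=
    Sum.rec (memLp_scaledSum (hkX r)) (memLp_scaledSum (hlY r))
  have hmean (r : R) : ∀ a, ∫ ω, Sum.elim (scaledSum (μ r) k (X r) ω)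
      (scaledSum (μ r) l (Y r) ω) a ∂(μ r) = 0 :=
    Sum.rec (integral_scaledSum (hX r) (hkX r)) (integral_scaledSum (hY r) (hlY r))
  have hlimit : ∀ a, MemLp (fun ω => Sum.elim (c ω) (d ω) a) 2 μ' := Sum.rec hc hd
  have hvar : ∀ a, Var[fun ω => Sum.elim (c ω) (d ω) a; μ'] = blockCov n σx2 σy2 σxy2 a a :=
    Sum.rec (fun a => (hvarc a).trans (by simp [blockCov]))
      fun a => (hvard a).trans (by simp [blockCov])
  exact ⟨integral_apply_eq_zero_of_tendsto_covariance hlim' hmemLp hlimit hmean hvar hcov,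
    covariance_apply_eq_of_tendsto_covariance hlim' hmemLp hlimit hmean hvar hcov⟩

theorem theorem3_general (hn : 4 ≤ n) (hX : ∀ r s i, Measurable (X r s i))
    (hY : ∀ r s j, Measurable (Y r s j))
    (hXY : ∀ r, iIndepFun (fun s ω => ((X r s · ω), (Y r s · ω))) (μ r))
    (hk : IsKernel k) (hl : IsKernel l)
    (hkX : ∀ r, KernelMoments (μ r) k (X r)) (hlY : ∀ r, KernelMoments (μ r) l (Y r))
    (hlim : TendstoInDistribution
      (fun r ω => (scaledSum (μ r) k (X r) ω, scaledSum (μ r) l (Y r) ω)) F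
      (fun ω => (c ω, d ω)) μ μ')
    (hgauss : HasGaussianLaw (fun ω => (c ω, d ω)) μ')
    (hvarc : ∀ a, Var[fun ω => c ω a; μ'] = σx2) (hvard : ∀ a, Var[fun ω => d ω a; μ'] = σy2)
    (hlimx : ∀ a : IdxPair n, Tendsto (fun r => 1 / (p r : ℝ) * ∑ i, ∑ j,
      cov[fun ω => doubleCentered (μ r) k (fun s => X r s i) ω a.1.1 a.1.2,
        fun ω => doubleCentered (μ r) k (fun s => X r s j) ω a.1.1 a.1.2; μ r]) F (𝓝 σx2))
    (hlimy : ∀ a : IdxPair n, Tendsto (fun r => 1 / (q r : ℝ) * ∑ i, ∑ j,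
      cov[fun ω => doubleCentered (μ r) l (fun s => Y r s i) ω a.1.1 a.1.2,
        fun ω => doubleCentered (μ r) l (fun s => Y r s j) ω a.1.1 a.1.2; μ r]) F (𝓝 σy2))
    (hlimxy : ∀ a : IdxPair n, Tendsto (fun r => 1 / √((p r : ℝ) * (q r : ℝ)) * ∑ i, ∑ j,
      cov[fun ω => doubleCentered (μ r) k (fun s => X r s i) ω a.1.1 a.1.2,
        fun ω => doubleCentered (μ r) l (fun s => Y r s j) ω a.1.1 a.1.2; μ r]) F (𝓝 σxy2))
    {v : ℕ} (hv : v = n * (n - 3) / 2) :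
    ((projMatrix n)ᵀ = projMatrix n ∧ projMatrix n * projMatrix n = projMatrix n ∧
      (projMatrix n).rank = v) ∧
    ((blockCov n σx2 σy2 σxy2).PosSemidef ∧
      HasLaw (fun ω => WithLp.toLp 2 (Sum.elim (c ω) (d ω)))
        (multivariateGaussian 0 (blockCov n σx2 σy2 σxy2)) μ') ∧
    TendstoInDistribution (fun r => uCov (μ r) k l (X r) (Y r)) F
      (fun ω => 1 / (v : ℝ) * (c ω ⬝ᵥ (projMatrix n *ᵥ d ω))) μ μ' ∧
    (TendstoInDistribution (fun r => uCov (μ r) k k (X r) (X r)) F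
        (fun ω => 1 / (v : ℝ) * (c ω ⬝ᵥ (projMatrix n *ᵥ c ω))) μ μ' ∧
      HasLaw (fun ω => 1 / (v : ℝ) * (c ω ⬝ᵥ (projMatrix n *ᵥ c ω)))
        ((chiSquare v).map fun z => σx2 / (v : ℝ) * z) μ') ∧
    (TendstoInDistribution (fun r => uCov (μ r) l l (Y r) (Y r)) F
        (fun ω => 1 / (v : ℝ) * (d ω ⬝ᵥ (projMatrix n *ᵥ d ω))) μ μ' ∧
      HasLaw (fun ω => 1 / (v : ℝ) * (d ω ⬝ᵥ (projMatrix n *ᵥ d ω)))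
        ((chiSquare v).map fun z => σy2 / (v : ℝ) * z) μ') := by
  have hn' : 3 ≤ n := by omega
  have hM := projMatrix_mul_self hn'
  have hMT := projMatrix_transpose n
  have hrank := projMatrix_rank hn' hv
  have hG := hasGaussianLaw_sumElim hgauss
  obtain ⟨hmean, hcov⟩ := integral_eq_zero_and_covariance_eq_blockCov hX hY hkX hlY hlim
    (fun a => (hgauss.fst.eval a).memLp_two) (fun a => (hgauss.snd.eval a).memLp_two) hvarc hvard
    (tendsto_covariance_sumElim_scaledSum hX hY hXY hk hl hkX hlY hlimx hlimy hlimxy)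
  let a₀ : IdxPair n := ⟨(⟨0, by omega⟩, ⟨1, by omega⟩), by simp [Fin.lt_def]⟩
  have hσx : 0 ≤ σx2 := hvarc a₀ ▸ variance_nonneg _ _
  have hσy : 0 ≤ σy2 := hvard a₀ ▸ variance_nonneg _ _
  refine ⟨⟨hMT, hM, hrank⟩, ⟨posSemidef_of_covariance (fun i => (hG.eval i).memLp_two) hcov,
    hasLaw_multivariateGaussian hG hmean hcov⟩, tendstoInDistribution_uCov hn' hv hk hl hlim,
    ⟨tendstoInDistribution_uCov hn' hv hk hk ?_, ?_⟩,
    ⟨tendstoInDistribution_uCov hn' hv hl hl ?_, ?_⟩⟩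
  · exact hlim.continuous_comp (g := fun z => (z.1, z.1)) (by fun_prop)
  · exact hasLaw_chiSquare_quadraticForm hMT hM hrank hgauss.fst hσx (fun a => hmean (.inl a))
      fun a b => hcov (.inl a) (.inl b)
  · exact hlim.continuous_comp (g := fun z => (z.2, z.2)) (by fun_prop)
  · exact hasLaw_chiSquare_quadraticForm hMT hM hrank hgauss.snd hσy (fun a => hmean (.inr a))
      fun a b => hcov (.inr a) (.inr b)

end JointLimit

theorem theorem3 (n : ℕ) (hn : 4 ≤ n)
    {Ω : ℕ × ℕ → Type*} [∀ r, MeasurableSpace (Ω r)]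
    (μ : (r : ℕ × ℕ) → Measure (Ω r)) [∀ r, IsProbabilityMeasure (μ r)]
    (P : (r : ℕ × ℕ) → Measure ((Fin r.1 → ℝ) × (Fin r.2 → ℝ)))
    (X : (r : ℕ × ℕ) → Fin n → Fin r.1 → Ω r → ℝ)
    (Y : (r : ℕ × ℕ) → Fin n → Fin r.2 → Ω r → ℝ)
    (hXY : ∀ r, IsIIDSample (μ r) (P r) (X r) (Y r))
    (k l : ℝ → ℝ → ℝ) (hk : IsKernel k) (hl : IsKernel l)
    (hkX : ∀ r, KernelMoments (μ r) k (X r)) (hlY : ∀ r, KernelMoments (μ r) l (Y r))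
    (hD1 : UniformMomentBounds P)
    {Ω' : Type*} [MeasurableSpace Ω'] (μ' : Measure Ω') [IsProbabilityMeasure μ']
    (c d : Ω' → IdxPair n → ℝ) (σx2 σy2 σxy2 : ℝ)
    (hD3 : JointGaussianCLT μ k l X Y μ' c d σx2 σy2 σxy2)
    (v : ℕ) (hv : v = n * (n - 3) / 2) :
    -- `𝐌` is a projection matrix of rank `v`
    ((projMatrix n)ᵀ = projMatrix n ∧ projMatrix n * projMatrix n = projMatrix n ∧
      (projMatrix n).rank = v) ∧
    -- the law of `(𝐜, 𝐝)`
    ((blockCov n σx2 σy2 σxy2).PosSemidef ∧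
      HasLaw (fun ω => WithLp.toLp 2 (Sum.elim (c ω) (d ω)))
        (multivariateGaussian 0 (blockCov n σx2 σy2 σxy2)) μ') ∧
    -- the limit of `uCov_n²(𝐗, 𝐘)`
    TendstoInDistribution (fun r => uCov (μ r) k l (X r) (Y r)) atTop
      (fun ω => 1 / (v : ℝ) * (c ω ⬝ᵥ (projMatrix n *ᵥ d ω))) μ μ' ∧
    -- the limit of `uCov_n²(𝐗, 𝐗)`
    (TendstoInDistribution (fun r => uCov (μ r) k k (X r) (X r)) atTop
        (fun ω => 1 / (v : ℝ) * (c ω ⬝ᵥ (projMatrix n *ᵥ c ω))) μ μ' ∧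
      HasLaw (fun ω => 1 / (v : ℝ) * (c ω ⬝ᵥ (projMatrix n *ᵥ c ω)))
        ((chiSquare v).map fun z => σx2 / (v : ℝ) * z) μ') ∧
    -- the limit of `uCov_n²(𝐘, 𝐘)`
    (TendstoInDistribution (fun r => uCov (μ r) l l (Y r) (Y r)) atTop
        (fun ω => 1 / (v : ℝ) * (d ω ⬝ᵥ (projMatrix n *ᵥ d ω))) μ μ' ∧
      HasLaw (fun ω => 1 / (v : ℝ) * (d ω ⬝ᵥ (projMatrix n *ᵥ d ω)))
        ((chiSquare v).map fun z => σy2 / (v : ℝ) * z) μ') :=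
  theorem3_general hn (fun r => (hXY r).measurable_X) (fun r => (hXY r).measurable_Y)
    (fun r => (hXY r).indep) hk hl hkX hlY hD3.tendsto ⟨hD3.gaussian⟩ hD3.var_c hD3.var_d
    hD3.tendsto_x hD3.tendsto_y hD3.tendsto_xy hv
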